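/- Let $\mathcal H_A,\mathcal H_B$ be finite-dimensional complex Hilbert spaces of dimensions $D_A,D_B$, and put $D=\min(D_A,D_B)$. For a unit vector $|\psi\rangle\in\mathcal H_A\otimes\mathcal H_B$ let $\lambda_0\le\lambda_1\le\dots\le\lambda_{D-1}$ be its Schmidt weights in increasing order (the $D$ largest eigenvalues, with multiplicity, of the reduced density operator $\mathrm{Tr}_A|\psi\rangle\langle\psi|$; these are all its eigenvalues if $D_B\le D_A$), and for $0\le n\le D-1$ let $E_n(\psi)=\sum_{j=0}^{n}\lambda_j$ be the sum of the $n+1$ smallest ones. A separable operation is a finite family of product operators $\{A_l\otimes B_l\}$ on $\mathcal H_A\otimes\mathcal H_B$ with $\sum_l A_l^\dagger A_l\otimes B_l^\dagger B_l=I_A\otimes I_B$. An LOCC operation is a family of product operators generated by a finite protocol in which, at each step, one of the two parties applies a local operation $\{K_i\}$ ($i$ in a finite set, $\sum_iK_i^\dagger K_i=I$ on that party's space), whose outcome $i$ is communicated to the other party; who acts next, and with which operation (or whether the protocol stops), may depend on all previous outcomes. The members of the family, one for each complete history of outcomes, are the products of the operators applied along that history. Such a family $\{A_l\otimes B_l\}$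 (separable or LOCC) acting on $|\psi\rangle$ produces the ensemble $\{p_k,|\phi_k\rangle\}_{k=0}^{N-1}$ if each $l$ can be assigned an index $f(l)\in\{0,\dots,N-1\}$ and a number $q_l\ge0$ such that $(A_l\otimes B_l)|\psi\rangle=\sqrt{q_l}\,|\phi_{f(l)}\rangle$ for all $l$ and $\sum_{l:\,f(l)=k}q_l=p_k$ for all $k$ (several Kraus operators may yield the same member of the ensemble). Theorem. Let $|\psi\rangle\in\mathcal H_A\otimes\mathcal H_B$ be normalized, and let $\{p_k,|\phi_k\rangle\}_{k=0}^{N-1}$ be an ensemble of normalized states of $\mathcal H_A\otimes\mathcal H_B$ with $p_k\ge0$, $\sum_kp_k=1$. Then $\{p_k,|\phi_k\rangle\}$ can be produced by some separable operation acting on $|\psi\rangle$ if and only if $$\sum_{k=0}^{N-1}p_kE_n(\phi_k)\le E_n(\psi)\qquad\text{for every }0\le n\le D-1.$$ Moreover, $\{p_k,|\phi_k\rangle\}$ can be produced by some separable operation acting on $|\psi\rangle$ if and only if it can be produced by some LOCC operation acting on $|\psi\rangle$. -/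

import Mathlib

open scoped Kronecker Matrix

universe u v

/-- The Hilbert space `ℋ_A ⊗ ℋ_B` of a bipartite system with `ℋ_A = ℂ^A`, `ℋ_B = ℂ^B`: the vector
`ψ` has the coordinate `ψ (a, b)` along `|a⟩ ⊗ |b⟩`. -/
abbrev BipartiteSpace (A : Type u) (B : Type v) : Type (max u v) :=
  EuclideanSpace ℂ (A × B)

section States

variable {A : Type u} {B : Type v} [Fintype A]

/-- Bob's reduced density matrix `Tr_A |ψ⟩⟨ψ|`. -/
noncomputable def reducedDensity (ψ : BipartiteSpace A B) : Matrix B B ℂ :=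
  Matrix.of fun b b' => ∑ a : A, ψ (a, b) * star (ψ (a, b'))

theorem reducedDensity_isHermitian (ψ : BipartiteSpace A B) :
    (reducedDensity ψ).IsHermitian := by
  ext b b'
  simp [reducedDensity, Matrix.conjTranspose_apply, mul_comm]

variable [Fintype B] [DecidableEq B]

/-- The Schmidt weights `λ_0 ≤ λ_1 ≤ ⋯ ≤ λ_{D-1}` of `ψ`, where `D = min D_A D_B`: the `D` largest
eigenvalues (with multiplicity) of `Tr_A |ψ⟩⟨ψ|`, in increasing order. If `D_B ≤ D_A` these are
all its eigenvalues; if `D_A < D_B` the `D_B - D_A` eigenvalues left out are all zero. Mathlib's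
`eigenvalues₀` lists the eigenvalues in decreasing order, hence the `rev`. -/
noncomputable def schmidtWeight (ψ : BipartiteSpace A B)
    (j : Fin (min (Fintype.card A) (Fintype.card B))) : ℝ :=
  (reducedDensity_isHermitian ψ).eigenvalues₀ (Fin.castLE (min_le_right _ _) j.rev)

/-- `E_n(ψ) = λ_0 + ⋯ + λ_n`, the sum of the `n + 1` smallest Schmidt weights. -/
noncomputable def schmidtTail (n : Fin (min (Fintype.card A) (Fintype.card B)))
    (ψ : BipartiteSpace A B) : ℝ :=
  ∑ j ∈ Finset.Iic n, schmidtWeight ψ j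

end States

section Operations

variable {A : Type u} {B : Type v} [Fintype A] [Fintype B] [DecidableEq A] [DecidableEq B]

/-- The product operators `X l ⊗ Y l` are the Kraus operators of a separable operation:
the closure condition `∑ l, (X l)† (X l) ⊗ (Y l)† (Y l) = I_A ⊗ I_B`. -/
def IsSeparableOperation {ι : Type} [Fintype ι] (X : ι → Matrix A A ℂ) (Y : ι → Matrix B B ℂ) :
    Prop :=
  ∑ l, ((X l)ᴴ * X l) ⊗ₖ ((Y l)ᴴ * Y l) = (1 : Matrix A A ℂ) ⊗ₖ (1 : Matrix B B ℂ)

/-- The operation with Kraus operators `X l ⊗ Y l`, applied to `ψ`, produces the ensemble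
`{p k, φ k}`: the outcome `l`, of probability `q l`, leaves the state `φ (f l)`, and the outcomes
that leave the `k`-th state have total probability `p k`. -/
def ProducesEnsemble {ι : Type} [Fintype ι] (X : ι → Matrix A A ℂ) (Y : ι → Matrix B B ℂ)
    (ψ : BipartiteSpace A B) {N : ℕ} (p : Fin N → ℝ) (φ : Fin N → BipartiteSpace A B) : Prop :=
  ∃ (f : ι → Fin N) (q : ι → ℝ),
    (∀ l, 0 ≤ q l) ∧
    (∀ l, Matrix.toEuclideanLin (X l ⊗ₖ Y l) ψ = ((Real.sqrt (q l) : ℝ) : ℂ) • φ (f l)) ∧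
    ∀ k, ∑ l with f l = k, q l = p k

/-- The ensemble `{p k, φ k}` can be produced from `ψ` by some separable operation. -/
def SeparablyProducible (ψ : BipartiteSpace A B) {N : ℕ} (p : Fin N → ℝ)
    (φ : Fin N → BipartiteSpace A B) : Prop :=
  ∃ (M : ℕ) (X : Fin M → Matrix A A ℂ) (Y : Fin M → Matrix B B ℂ),
    IsSeparableOperation X Y ∧ ProducesEnsemble X Y ψ p φ

variable (A B) in
/-- An LOCC protocol with finitely many rounds: either nothing more is done, or one party carries
out a local operation `{K i}`, `∑ i, (K i)† (K i) = I`, communicates the result `i`, and the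
parties go on with a protocol that depends on `i`. -/
inductive LOCCProtocol : Type (max u v)
  | done : LOCCProtocol
  | alice (m : ℕ) (K : Fin m → Matrix A A ℂ) (hK : ∑ i, (K i)ᴴ * K i = 1)
      (next : Fin m → LOCCProtocol) : LOCCProtocol
  | bob (m : ℕ) (K : Fin m → Matrix B B ℂ) (hK : ∑ i, (K i)ᴴ * K i = 1)
      (next : Fin m → LOCCProtocol) : LOCCProtocol

namespace LOCCProtocol

/-- The possible histories of measurement results of a protocol. -/
def History : LOCCProtocol A B → Type
  | done => Unit
  | alice m _ _ next => Σ i : Fin m, (next i).History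
  | bob m _ _ next => Σ i : Fin m, (next i).History

/-- A protocol has finitely many histories. -/
instance fintypeHistory : (P : LOCCProtocol A B) → Fintype P.History
  | done => inferInstanceAs (Fintype Unit)
  | alice m _ _ next =>
      letI := fun i => fintypeHistory (next i)
      inferInstanceAs (Fintype (Σ i : Fin m, (next i).History))
  | bob m _ _ next =>
      letI := fun i => fintypeHistory (next i)
      inferInstanceAs (Fintype (Σ i : Fin m, (next i).History))

/-- Alice's factor of the Kraus operator of a history (the earliest operation acts first). -/
def aliceKraus : (P : LOCCProtocol A B) → P.History → Matrix A A ℂ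
  | done, _ => 1
  | alice _ K _ next, ⟨i, h⟩ => aliceKraus (next i) h * K i
  | bob _ _ _ next, ⟨i, h⟩ => aliceKraus (next i) h

/-- Bob's factor of the Kraus operator of a history. -/
def bobKraus : (P : LOCCProtocol A B) → P.History → Matrix B B ℂ
  | done, _ => 1
  | alice _ _ _ next, ⟨i, h⟩ => bobKraus (next i) h
  | bob _ K _ next, ⟨i, h⟩ => bobKraus (next i) h * K i

end LOCCProtocol

/-- The ensemble `{p k, φ k}` can be produced from `ψ` by some LOCC protocol. -/
def LOCCProducible (ψ : BipartiteSpace A B) {N : ℕ} (p : Fin N → ℝ)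
    (φ : Fin N → BipartiteSpace A B) : Prop :=
  ∃ P : LOCCProtocol A B, ProducesEnsemble P.aliceKraus P.bobKraus ψ p φ

end Operations

/-!
Write a vector of `ℋ_A ⊗ ℋ_B` as its coordinate matrix `G`, with rows indexed by `B`. Then
`Tr_A |ψ⟩⟨ψ| = G Gᴴ`, and `X ⊗ Y` acts by `G ↦ Y G Xᵀ`.

Necessity of the inequalities rests on the Eckart–Young theorem: `E_n(ψ)` is the least squared
Frobenius distance from `G` to a matrix of rank at most `D - 1 - n`
(`spectralTail_le_frobeniusSq_sub`, `exists_rank_le_frobeniusSq_sub_eq`). Let `R` be a best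
approximation of `ψ`. Product operators do not increase the rank, so `(X l ⊗ Y l) R` is a competitor
for the `l`-th outcome, at squared distance `‖(X l ⊗ Y l) (ψ - R)‖²` from it; by the closure
condition these squared distances add up to `‖ψ - R‖² = E_n(ψ)`
(`SeparablyProducible.sum_mul_schmidtTail_le`).

For sufficiency, the inequalities say that the Schmidt weights of `ψ` are majorized by the averages
`∑ k, p k * λ_j(φ k)`, so they are a convex combination of permutations of these averages; this
follows from Hahn–Banach separation and the rearrangement inequality
(`exists_convex_combination_perm`). Hence the weights of `ψ` are an average of permuted weights of
the `φ k`, and a single diagonal measurement by Bob in the Schmidt basis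
(`exists_diagonal_measurement`), with local unitaries given by the Schmidt decomposition
(`exists_schmidt_decomposition`), produces the ensemble. This is an LOCC protocol
(`LOCCProducible.of_sum_mul_schmidtTail_le`), and every LOCC protocol is a separable operation
(`LOCCProtocol.isSeparableOperation`), which closes the circle.
-/

/-! ### Best approximation by matrices of bounded rank -/

section EckartYoung

open scoped ComplexOrder

variable {m n : Type*} [Fintype m] [Fintype n]

/-- The squared Frobenius norm `Tr (M Mᴴ)`. -/
noncomputable def frobeniusSq (M : Matrix m n ℂ) : ℝ :=
  (M * Mᴴ).trace.re

theorem frobeniusSq_eq_sum (M : Matrix m n ℂ) :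
    frobeniusSq M = ∑ i, ∑ j, ‖M i j‖ ^ 2 := by
  simp only [frobeniusSq, Matrix.trace, Matrix.diag_apply, Matrix.mul_apply,
    Matrix.conjTranspose_apply, Complex.re_sum, Complex.star_def, Complex.mul_conj,
    Complex.ofReal_re, Complex.normSq_eq_norm_sq]

theorem frobeniusSq_nonneg (M : Matrix m n ℂ) : 0 ≤ frobeniusSq M := by
  rw [frobeniusSq_eq_sum]
  positivity

theorem frobeniusSq_projection_mul {Q : Matrix m m ℂ} (hQ : Q.IsHermitian) (hQ2 : Q * Q = Q)
    (M : Matrix m n ℂ) : frobeniusSq (Q * M) = (Q * (M * Mᴴ)).trace.re := by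
  rw [frobeniusSq, Matrix.conjTranspose_mul, hQ.eq, ← Matrix.mul_assoc, Matrix.trace_mul_comm,
    ← Matrix.mul_assoc, ← Matrix.mul_assoc, hQ2, Matrix.mul_assoc]

theorem frobeniusSq_projection_mul_le {Q : Matrix m m ℂ} (hQ : Q.IsHermitian) (hQ2 : Q * Q = Q)
    (M : Matrix m n ℂ) : frobeniusSq (Q * M) ≤ frobeniusSq M := by
  classical
  have h1 : (1 - Q).IsHermitian := Matrix.isHermitian_one.sub hQ
  have h2 : (1 - Q) * (1 - Q) = 1 - Q := by
    rw [Matrix.sub_mul, Matrix.mul_sub, Matrix.mul_sub, hQ2]; simp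
  have h := frobeniusSq_nonneg ((1 - Q) * M)
  rw [frobeniusSq_projection_mul h1 h2, Matrix.sub_mul, Matrix.trace_sub, Complex.sub_re,
    Matrix.one_mul] at h
  rw [frobeniusSq_projection_mul hQ hQ2, frobeniusSq]
  linarith

namespace Matrix.IsHermitian

/-- The position in the decreasing list `eigenvalues₀` of the eigenvalue that `eigenvalues` gives
the index `b : m`. -/
noncomputable def eigenRank (m : Type*) [Fintype m] : m ≃ Fin (Fintype.card m) :=
  (Fintype.equivOfCardEq (Fintype.card_fin _)).symm

theorem card_eigenRank_lt {r : ℕ} (hr : r ≤ Fintype.card m) :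
    Fintype.card {b : m // (eigenRank m b).val < r} = r := by
  rw [Fintype.card_congr ((eigenRank m).subtypeEquiv (q := fun i => i.val < r) fun _ => Iff.rfl),
    Fintype.card_subtype, Fin.card_filter_val_lt, min_eq_right hr]

variable [DecidableEq m]

variable {H : Matrix m m ℂ} (hH : H.IsHermitian)

theorem eigenvalues_eq_eigenvalues₀ (b : m) :
    hH.eigenvalues b = hH.eigenvalues₀ (eigenRank m b) := rfl

/-- The function of `H` that takes the value `f b` on the `b`-th eigenvector. -/
noncomputable def spectralMap (f : m → ℂ) : Matrix m m ℂ :=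
  (hH.eigenvectorUnitary : Matrix m m ℂ) * Matrix.diagonal f *
    (hH.eigenvectorUnitary : Matrix m m ℂ)ᴴ

theorem eigenvectorUnitary_conjTranspose_mul_self :
    (hH.eigenvectorUnitary : Matrix m m ℂ)ᴴ * (hH.eigenvectorUnitary : Matrix m m ℂ) = 1 :=
  Unitary.coe_star_mul_self hH.eigenvectorUnitary

theorem eigenvectorUnitary_mul_conjTranspose_self :
    (hH.eigenvectorUnitary : Matrix m m ℂ) * (hH.eigenvectorUnitary : Matrix m m ℂ)ᴴ = 1 :=
  Unitary.coe_mul_star_self hH.eigenvectorUnitary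

theorem spectralMap_eigenvalues : hH.spectralMap (fun b => (hH.eigenvalues b : ℂ)) = H := by
  conv_rhs => rw [hH.spectral_theorem]
  rfl

theorem spectralMap_mul (f g : m → ℂ) :
    hH.spectralMap f * hH.spectralMap g = hH.spectralMap (f * g) := by
  simp only [spectralMap]
  calc _ = (hH.eigenvectorUnitary : Matrix m m ℂ) * Matrix.diagonal f *
        ((hH.eigenvectorUnitary : Matrix m m ℂ)ᴴ * (hH.eigenvectorUnitary : Matrix m m ℂ)) *
        Matrix.diagonal g * (hH.eigenvectorUnitary : Matrix m m ℂ)ᴴ := by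
        simp only [Matrix.mul_assoc]
    _ = _ := by
        rw [eigenvectorUnitary_conjTranspose_mul_self, Matrix.mul_one, Matrix.mul_assoc _ _
          (Matrix.diagonal g), Matrix.diagonal_mul_diagonal]
        rfl

theorem spectralMap_mul_self (f : m → ℂ) :
    hH.spectralMap f * H = hH.spectralMap (fun b => f b * (hH.eigenvalues b : ℂ)) :=
  calc hH.spectralMap f * H
      = hH.spectralMap f * hH.spectralMap (fun b => (hH.eigenvalues b : ℂ)) := by
        rw [spectralMap_eigenvalues]
    _ = _ := hH.spectralMap_mul _ _

theorem spectralMap_one : hH.spectralMap 1 = 1 := by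
  simp only [spectralMap, Matrix.diagonal_one', Matrix.mul_one,
    eigenvectorUnitary_mul_conjTranspose_self]

theorem spectralMap_sub (f g : m → ℂ) :
    hH.spectralMap (f - g) = hH.spectralMap f - hH.spectralMap g := by
  simp only [spectralMap, ← Matrix.sub_mul, ← Matrix.mul_sub, Matrix.diagonal_sub, Pi.sub_def]

theorem trace_spectralMap (f : m → ℂ) : (hH.spectralMap f).trace = ∑ b, f b := by
  rw [spectralMap, Matrix.trace_mul_comm, ← Matrix.mul_assoc,
    eigenvectorUnitary_conjTranspose_mul_self, Matrix.one_mul, Matrix.trace_diagonal]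

theorem isHermitian_spectralMap (f : m → ℂ) (hf : ∀ b, star (f b) = f b) :
    (hH.spectralMap f).IsHermitian := by
  have : (Matrix.diagonal f).IsHermitian := Matrix.isHermitian_diagonal_iff.2 hf
  exact Matrix.isHermitian_mul_mul_conjTranspose _ this

theorem rank_spectralMap_le (f : m → ℂ) :
    (hH.spectralMap f).rank ≤ Fintype.card {b // f b ≠ 0} := by
  classical
  rw [← Matrix.rank_diagonal]
  exact (Matrix.rank_mul_le_left _ _).trans (Matrix.rank_mul_le_right _ _)

/-- The sum of all eigenvalues but the `r` largest ones. -/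
noncomputable def spectralTail (r : ℕ) : ℝ :=
  ∑ i : Fin (Fintype.card m) with r ≤ i.val, hH.eigenvalues₀ i

theorem spectralTail_eq_sum (r : ℕ) :
    hH.spectralTail r = ∑ b, hH.eigenvalues b * (if r ≤ (eigenRank m b).val then 1 else 0) := by
  rw [spectralTail, Finset.sum_filter, ← (eigenRank m).sum_comp]
  refine Finset.sum_congr rfl fun b _ => ?_
  rw [eigenvalues_eq_eigenvalues₀, mul_ite, mul_one, mul_zero]

/-- A weighted sum of the eigenvalues, with weights in `[0, 1]` of total at least `card m - r`,
is at least the sum of the `card m - r` smallest ones. -/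
theorem spectralTail_le_sum_mul {r : ℕ} (hr : r < Fintype.card m) (w : m → ℝ)
    (h0 : ∀ b, 0 ≤ w b) (h1 : ∀ b, w b ≤ 1) (hw : (Fintype.card m : ℝ) - r ≤ ∑ b, w b)
    (hpos : ∀ b, 0 ≤ hH.eigenvalues b) :
    hH.spectralTail r ≤ ∑ b, hH.eigenvalues b * w b := by
  set c := hH.eigenvalues₀ ⟨r, hr⟩ with hc
  have hc0 : 0 ≤ c := by
    have := hpos ((eigenRank m).symm ⟨r, hr⟩)
    rwa [eigenvalues_eq_eigenvalues₀, Equiv.apply_symm_apply] at this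
  set t : m → ℝ := fun b => if r ≤ (eigenRank m b).val then 1 else 0 with ht
  have hsum : ∑ b, t b = (Fintype.card m : ℝ) - r := by
    have h2 : ∑ b, (1 - t b) = r := by
      have : ∀ b, 1 - t b = if (eigenRank m b).val < r then 1 else 0 := by
        intro b
        by_cases h : r ≤ (eigenRank m b).val
        · simp [ht, h, not_lt.2 h]
        · simp [ht, h, not_le.1 h]
      simp only [this, Finset.sum_boole]
      rw [← Fintype.card_subtype, card_eigenRank_lt hr.le]
    rw [Finset.sum_sub_distrib] at h2
    simp only [Finset.sum_const, Finset.card_univ, nsmul_eq_mul, mul_one] at h2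
    linarith
  -- Compare termwise with the threshold `c`, the largest eigenvalue of the tail.
  have hterm : ∀ b, c * (w b - t b) ≤ hH.eigenvalues b * (w b - t b) := by
    intro b
    rw [eigenvalues_eq_eigenvalues₀]
    by_cases h : r ≤ (eigenRank m b).val
    · have hle : hH.eigenvalues₀ (eigenRank m b) ≤ c := hH.eigenvalues₀_antitone h
      have : t b = 1 := if_pos h
      rw [this]
      nlinarith [h1 b]
    · have hle : c ≤ hH.eigenvalues₀ (eigenRank m b) :=
        hH.eigenvalues₀_antitone (Fin.le_def.2 (not_le.1 h).le)
      have : t b = 0 := if_neg h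
      rw [this]
      nlinarith [h0 b]
  have h3 := Finset.sum_le_sum fun b (_ : b ∈ Finset.univ) => hterm b
  rw [← Finset.mul_sum] at h3
  simp only [mul_sub, Finset.sum_sub_distrib] at h3
  rw [spectralTail_eq_sum]
  have h4 : 0 ≤ c * (∑ b, w b - ∑ b, t b) := mul_nonneg hc0 (by linarith)
  change ∑ b, hH.eigenvalues b * t b ≤ _
  linarith

end Matrix.IsHermitian

open Matrix.IsHermitian

/-- The orthogonal projection onto the column space of a matrix. -/
theorem exists_projection_onto_columns (R : Matrix m n ℂ) :
    ∃ P : Matrix m m ℂ, P.IsHermitian ∧ P * P = P ∧ P * R = R ∧ P.trace = R.rank := by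
  classical
  have hR : (R * Rᴴ).IsHermitian := Matrix.isHermitian_mul_conjTranspose_self R
  set f : m → ℂ := fun b => if hR.eigenvalues b = 0 then 0 else 1 with hf
  have hff : f * f = f := by
    ext b
    by_cases h : hR.eigenvalues b = 0 <;> simp [hf, h]
  have hherm : (hR.spectralMap f).IsHermitian := by
    refine isHermitian_spectralMap _ _ fun b => ?_
    by_cases h : hR.eigenvalues b = 0 <;> simp [hf, h]
  refine ⟨hR.spectralMap f, hherm, by rw [spectralMap_mul, hff], ?_, ?_⟩
  · have h1 : hR.spectralMap f * (R * Rᴴ) = R * Rᴴ := by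
      rw [spectralMap_mul_self]
      refine Eq.trans ?_ hR.spectralMap_eigenvalues
      congr 1
      ext b
      by_cases h : hR.eigenvalues b = 0 <;> simp [hf, h]
    -- `(1 - P) R Rᴴ = 0` forces `(1 - P) R = 0`.
    have h2 : (R - hR.spectralMap f * R) * (R - hR.spectralMap f * R)ᴴ = 0 := by
      have : (R - hR.spectralMap f * R) * Rᴴ = 0 := by
        rw [Matrix.sub_mul, Matrix.mul_assoc, h1, sub_self]
      rw [Matrix.conjTranspose_sub, Matrix.conjTranspose_mul, Matrix.mul_sub,
        ← Matrix.mul_assoc, this, Matrix.zero_mul, sub_zero]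
    exact (sub_eq_zero.1 (Matrix.self_mul_conjTranspose_eq_zero.1 h2)).symm
  · rw [trace_spectralMap, ← Matrix.rank_self_mul_conjTranspose, hR.rank_eq_card_non_zero_eigs,
      Fintype.card_subtype, Finset.card_filter, Nat.cast_sum]
    refine Finset.sum_congr rfl fun b _ => ?_
    by_cases h : hR.eigenvalues b = 0 <;> simp [hf, h]

/-- The lower bound in the Eckart–Young theorem. -/
theorem spectralTail_le_frobeniusSq_sub [DecidableEq m] (G R : Matrix m n ℂ)
    (hG : (G * Gᴴ).IsHermitian) {r : ℕ} (hr : r < Fintype.card m) (hR : R.rank ≤ r) :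
    hG.spectralTail r ≤ frobeniusSq (G - R) := by
  obtain ⟨P, hP, hP2, hPR, htr⟩ := exists_projection_onto_columns R
  have hQ : (1 - P).IsHermitian := Matrix.isHermitian_one.sub hP
  have hQ2 : (1 - P) * (1 - P) = 1 - P := by
    rw [Matrix.sub_mul, Matrix.mul_sub, Matrix.mul_sub, hP2]; simp
  have hQG : (1 - P) * (G - R) = (1 - P) * G := by
    rw [Matrix.mul_sub, Matrix.sub_mul 1 P R, hPR]; simp
  refine le_trans ?_ (frobeniusSq_projection_mul_le hQ hQ2 (G - R))
  rw [hQG, frobeniusSq_projection_mul hQ hQ2]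
  set E : Matrix m m ℂ := (hG.eigenvectorUnitary : Matrix m m ℂ) with hE
  have hEE : Eᴴ * E = 1 := hG.eigenvectorUnitary_conjTranspose_mul_self
  have hEE' : E * Eᴴ = 1 := hG.eigenvectorUnitary_mul_conjTranspose_self
  have hdiag : ∀ S : Matrix m m ℂ, S.IsHermitian → S * S = S → ∀ b,
      0 ≤ ((Eᴴ * S * E) b b).re := by
    intro S hS hS2 b
    have h : Eᴴ * S * E = (S * E)ᴴ * (S * E) := by
      rw [Matrix.conjTranspose_mul, hS.eq, Matrix.mul_assoc, Matrix.mul_assoc,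
        ← Matrix.mul_assoc S S, hS2]
    rw [h]
    exact (Complex.le_def.1 ((Matrix.posSemidef_conjTranspose_mul_self (S * E)).diag_nonneg
      (i := b))).1
  have key : ((1 - P) * (G * Gᴴ)).trace.re
      = ∑ b, hG.eigenvalues b * ((Eᴴ * (1 - P) * E) b b).re := by
    have h : (1 - P) * (G * Gᴴ)
        = (1 - P) * hG.spectralMap (fun b => (hG.eigenvalues b : ℂ)) := by
      rw [spectralMap_eigenvalues]
    rw [h, spectralMap, ← hE, ← Matrix.mul_assoc, Matrix.trace_mul_comm, ← Matrix.mul_assoc,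
      ← Matrix.mul_assoc, Matrix.trace, Complex.re_sum]
    refine Finset.sum_congr rfl fun b _ => ?_
    rw [Matrix.diag_apply, Matrix.mul_diagonal, Complex.re_mul_ofReal, mul_comm]
  rw [key]
  refine hG.spectralTail_le_sum_mul hr _ (hdiag _ hQ hQ2) ?_ ?_ ?_
  · intro b
    have h := hdiag P hP hP2 b
    have h2 : Eᴴ * (1 - P) * E = 1 - Eᴴ * P * E := by
      rw [Matrix.mul_sub, Matrix.sub_mul, Matrix.mul_one, hEE]
    rw [h2, Matrix.sub_apply, Matrix.one_apply_eq, Complex.sub_re, Complex.one_re]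
    linarith
  · have h : ∑ b, ((Eᴴ * (1 - P) * E) b b).re = (Eᴴ * (1 - P) * E).trace.re := by
      rw [Matrix.trace, Complex.re_sum]; rfl
    rw [h, Matrix.trace_mul_comm, ← Matrix.mul_assoc, hEE', Matrix.one_mul, Matrix.trace_sub,
      htr, Matrix.trace_one, Complex.sub_re, Complex.natCast_re, Complex.natCast_re]
    have : (R.rank : ℝ) ≤ r := by exact_mod_cast hR
    linarith
  · exact (Matrix.posSemidef_self_mul_conjTranspose G).eigenvalues_nonneg

/-- The bound in the Eckart–Young theorem is attained. -/
theorem exists_rank_le_frobeniusSq_sub_eq [DecidableEq m] (G : Matrix m n ℂ)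
    (hG : (G * Gᴴ).IsHermitian) {r : ℕ} (hr : r ≤ Fintype.card m) :
    ∃ R : Matrix m n ℂ, R.rank ≤ r ∧ frobeniusSq (G - R) = hG.spectralTail r := by
  set f : m → ℂ := fun b => if (eigenRank m b).val < r then 1 else 0 with hf
  have hg : ∀ b, (1 - f) b = if r ≤ (eigenRank m b).val then 1 else 0 := by
    intro b
    by_cases h : (eigenRank m b).val < r
    · simp [hf, h]
    · simp [hf, h, not_lt.1 h]
  have hherm : (hG.spectralMap (1 - f)).IsHermitian :=
    isHermitian_spectralMap _ _ fun b => by rw [hg]; split_ifs <;> simp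
  have hidem : hG.spectralMap (1 - f) * hG.spectralMap (1 - f) = hG.spectralMap (1 - f) := by
    rw [spectralMap_mul]
    congr 1
    ext b
    rw [Pi.mul_apply, hg]; split_ifs <;> simp
  refine ⟨hG.spectralMap f * G, ?_, ?_⟩
  · refine (Matrix.rank_mul_le_left _ _).trans ((hG.rank_spectralMap_le f).trans ?_)
    refine le_of_le_of_eq ?_ (card_eigenRank_lt hr)
    refine Fintype.card_le_of_injective (fun b => ⟨b.1, ?_⟩) ?_
    · by_contra h
      exact b.2 (by simp only [hf, h, if_false])
    · intro b c h
      exact Subtype.ext (congrArg (fun z => z.1) h)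
  · have h : G - hG.spectralMap f * G = hG.spectralMap (1 - f) * G := by
      rw [spectralMap_sub, spectralMap_one, Matrix.sub_mul, Matrix.one_mul]
    rw [h, frobeniusSq_projection_mul hherm hidem]
    rw [spectralMap_mul_self, trace_spectralMap, Complex.re_sum, spectralTail_eq_sum]
    refine Finset.sum_congr rfl fun b _ => ?_
    rw [hg, Complex.re_mul_ofReal, mul_comm]
    split_ifs <;> simp

end EckartYoung

/-! ### Majorization and convex hulls of permutations -/

section Majorization

/-- If all partial sums of `z` are nonpositive, summation by parts bounds its pairing with a
monotone sequence below by the boundary term. -/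
theorem mul_sum_le_sum_mul_of_monotone {d : ℕ} (c z : Fin (d + 1) → ℝ) (hc : Monotone c)
    (hz : ∀ n, ∑ j ∈ Finset.Iic n, z j ≤ 0) :
    c (Fin.last d) * ∑ j, z j ≤ ∑ j, c j * z j := by
  induction d with
  | zero => simp
  | succ d ih =>
    have hcast : ∀ n : Fin (d + 1), ∑ j ∈ Finset.Iic n, z j.castSucc
        = ∑ j ∈ Finset.Iic n.castSucc, z j := by
      intro n
      rw [← Fin.map_castSuccEmb_Iic, Finset.sum_map]
      rfl
    have h1 := ih (fun j => c j.castSucc) (fun j => z j.castSucc)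
      (fun i j h => hc (Fin.castSucc_le_castSucc_iff.2 h)) fun n => by rw [hcast]; exact hz _
    have h2 : ∑ j : Fin (d + 1), z j.castSucc ≤ 0 := by
      have := hcast (Fin.last d)
      rw [← Fin.top_eq_last, Finset.Iic_top] at this
      rw [this]
      exact hz _
    have h3 : c (Fin.last d).castSucc ≤ c (Fin.last (d + 1)) := hc (Fin.le_last _)
    rw [Fin.sum_univ_castSucc, Fin.sum_univ_castSucc (fun j => c j * z j)]
    nlinarith

/-- If `x` is majorized by `y`, both listed in increasing order, then `x` is a convex combination
of the rearrangements of `y`. -/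
theorem exists_convex_combination_perm {d : ℕ} (x y : Fin d → ℝ) (hx : Monotone x)
    (hxy : ∀ n, ∑ j ∈ Finset.Iic n, y j ≤ ∑ j ∈ Finset.Iic n, x j) (hsum : ∑ j, x j = ∑ j, y j) :
    ∃ w : Equiv.Perm (Fin d) → ℝ, (∀ σ, 0 ≤ w σ) ∧ ∑ σ, w σ = 1 ∧
      ∀ j, x j = ∑ σ, w σ * y (σ j) := by
  set v : Equiv.Perm (Fin d) → Fin d → ℝ := fun σ j => y (σ j) with hv
  have hmem : x ∈ convexHull ℝ (Set.range v) := by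
    by_contra hx'
    -- A linear functional separates `x` from the rearrangements of `y`.
    obtain ⟨f, u, hfu, hux⟩ := geometric_hahn_banach_closed_point
      (convex_convexHull ℝ (Set.range v))
      ((Set.finite_range v).isClosed_convexHull ℝ) hx'
    set c : Fin d → ℝ := fun j => f (Pi.single j 1) with hc
    have hf : ∀ z : Fin d → ℝ, f z = ∑ j, c j * z j := by
      intro z
      conv_lhs => rw [pi_eq_sum_univ' (R := ℝ) z]
      rw [map_sum]
      refine Finset.sum_congr rfl fun j _ => ?_
      rw [map_smul, smul_eq_mul, mul_comm]
    set τ := Tuple.sort c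
    have hτ : Monotone (c ∘ τ) := Tuple.monotone_sort c
    have h1 : ∑ j, c j * x j ≤ ∑ j, c (τ j) * x j := by
      have := (hτ.monovary hx).sum_comp_perm_mul_le_sum_mul (σ := τ⁻¹)
      simpa using this
    have h2 : ∑ j, c (τ j) * x j ≤ ∑ j, c (τ j) * y j := by
      rcases d with _ | d
      · simp
      · have := mul_sum_le_sum_mul_of_monotone (c ∘ τ) (fun j => y j - x j) hτ fun n => by
          rw [Finset.sum_sub_distrib]
          linarith [hxy n]
        rw [Finset.sum_sub_distrib, hsum, sub_self, mul_zero] at this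
        simp only [mul_sub, Finset.sum_sub_distrib, Function.comp_apply] at this
        linarith
    have h3 : ∑ j, c (τ j) * y j = f (v τ⁻¹) := by
      rw [hf, ← Equiv.sum_comp τ fun j => c j * v τ⁻¹ j]
      simp [hv]
    have h4 := hfu _ (subset_convexHull ℝ _ (Set.mem_range_self (f := v) τ⁻¹))
    rw [hf] at hux
    linarith
  rw [convexHull_range_eq_exists_affineCombination] at hmem
  obtain ⟨s, w, hw0, hw1, hwx⟩ := hmem
  rw [s.affineCombination_eq_linear_combination v w hw1] at hwx
  refine ⟨fun σ => if σ ∈ s then w σ else 0, fun σ => ?_, ?_, fun j => ?_⟩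
  · beta_reduce
    split_ifs with h
    exacts [hw0 σ h, le_rfl]
  · simpa [Finset.sum_ite_mem] using hw1
  · simp [← hwx, hv, ite_mul, Finset.sum_ite_mem, Finset.sum_apply]

end Majorization

/-! ### Bipartite states and their Schmidt decomposition -/

section Schmidt

open scoped ComplexOrder

open Matrix.IsHermitian

variable {A : Type u} {B : Type v}

/-- The matrix of coordinates of a bipartite vector, with rows indexed by Bob's basis. -/
def coeffMatrix (ψ : BipartiteSpace A B) : Matrix B A ℂ :=
  Matrix.of fun b a => ψ (a, b)

theorem reducedDensity_eq [Fintype A] (ψ : BipartiteSpace A B) :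
    reducedDensity ψ = coeffMatrix ψ * (coeffMatrix ψ)ᴴ := rfl

theorem coeffMatrix_injective : Function.Injective (coeffMatrix (A := A) (B := B)) := by
  intro ψ φ h
  ext ⟨a, b⟩
  exact congrFun (congrFun h b) a

theorem coeffMatrix_smul (c : ℂ) (ψ : BipartiteSpace A B) :
    coeffMatrix (c • ψ) = c • coeffMatrix ψ := rfl

variable [Fintype A] [Fintype B]

theorem norm_sq_eq_frobeniusSq (ψ : BipartiteSpace A B) :
    ‖ψ‖ ^ 2 = frobeniusSq (coeffMatrix ψ) := by
  rw [frobeniusSq_eq_sum, EuclideanSpace.norm_sq_eq, Fintype.sum_prod_type, Finset.sum_comm]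
  rfl

variable [DecidableEq A] [DecidableEq B]

/-- A product operator acts on the coordinate matrix by multiplication on both sides. -/
theorem coeffMatrix_kronecker (X : Matrix A A ℂ) (Y : Matrix B B ℂ) (ψ : BipartiteSpace A B) :
    coeffMatrix (Matrix.toEuclideanLin (X ⊗ₖ Y) ψ) = Y * coeffMatrix ψ * Xᵀ := by
  have h := Matrix.kronecker_mulVec_vec Y (coeffMatrix ψ) X
  ext b a
  exact congrFun h (a, b)

omit [DecidableEq A] in
/-- At most `card A` eigenvalues of Bob's reduced density matrix are nonzero. -/
theorem eigenvalues₀_reducedDensity_eq_zero (ψ : BipartiteSpace A B) (i : Fin (Fintype.card B))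
    (hi : Fintype.card A ≤ i.val) : (reducedDensity_isHermitian ψ).eigenvalues₀ i = 0 := by
  set hH := reducedDensity_isHermitian ψ
  have hpos : ∀ b, 0 ≤ hH.eigenvalues b :=
    (Matrix.posSemidef_self_mul_conjTranspose (coeffMatrix ψ)).eigenvalues_nonneg
  by_contra hne
  have hi0 : 0 < hH.eigenvalues₀ i := by
    refine lt_of_le_of_ne ?_ (Ne.symm hne)
    have := hpos ((eigenRank B).symm i)
    rwa [eigenvalues_eq_eigenvalues₀, Equiv.apply_symm_apply] at this
  have hrank : (reducedDensity ψ).rank ≤ Fintype.card A := by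
    rw [reducedDensity_eq]
    exact (Matrix.rank_mul_le_left _ _).trans (Matrix.rank_le_card_width _)
  -- All eigenvalues up to the `i`-th are positive, so that the rank would exceed `card A`.
  have h1 : Fintype.card {b : B // (eigenRank B b).val < i.val + 1}
      ≤ Fintype.card {b // hH.eigenvalues b ≠ 0} := by
    refine Fintype.card_le_of_injective (fun b => ⟨b.1, ?_⟩) ?_
    · have : hH.eigenvalues₀ i ≤ hH.eigenvalues b.1 :=
        hH.eigenvalues₀_antitone (Fin.le_def.2 (Nat.lt_succ_iff.1 b.2))
      exact (hi0.trans_le this).ne'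
    · intro b c h
      exact Subtype.ext (congrArg (fun z => z.1) h)
  rw [card_eigenRank_lt i.isLt, ← hH.rank_eq_card_non_zero_eigs] at h1
  omega

omit [DecidableEq A] in
/-- The indices `n + 1, …, D - 1` left out of `E_n` are the `n.rev` largest weights, and the
eigenvalues that are not Schmidt weights vanish. -/
theorem schmidtTail_eq_spectralTail (n : Fin (min (Fintype.card A) (Fintype.card B)))
    (ψ : BipartiteSpace A B) :
    schmidtTail n ψ = (reducedDensity_isHermitian ψ).spectralTail n.rev := by
  refine Finset.sum_of_injOn (fun j => Fin.castLE (min_le_right _ _) j.rev) ?_ ?_ ?_ ?_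
  · intro i _ j _ h
    exact Fin.rev_injective (Fin.castLE_injective _ h)
  · intro j hj
    have hj' : j ≤ n := by simpa using hj
    exact Finset.mem_coe.2 (Finset.mem_filter.2
      ⟨Finset.mem_univ _, Fin.le_def.1 (Fin.rev_le_rev.2 hj')⟩)
  · intro i hi hne
    apply eigenvalues₀_reducedDensity_eq_zero
    by_contra hlt
    have hD : i.val < min (Fintype.card A) (Fintype.card B) := lt_min (not_le.1 hlt) i.isLt
    refine hne ⟨(⟨i.val, hD⟩ : Fin _).rev, ?_, ?_⟩
    · have : (n.rev).val ≤ i.val := by simpa using hi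
      have h2 : (⟨i.val, hD⟩ : Fin (min (Fintype.card A) (Fintype.card B))).rev ≤ n.rev.rev :=
        Fin.rev_le_rev.2 (Fin.le_def.2 this)
      simpa using h2
    · simp
  · intro j _
    rfl

omit [DecidableEq A] in
theorem schmidtWeight_nonneg (ψ : BipartiteSpace A B) (j) : 0 ≤ schmidtWeight ψ j := by
  have := (Matrix.posSemidef_self_mul_conjTranspose (coeffMatrix ψ)).eigenvalues_nonneg
    ((eigenRank B).symm (Fin.castLE (min_le_right _ _) j.rev))
  rwa [eigenvalues_eq_eigenvalues₀, Equiv.apply_symm_apply] at this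

omit [DecidableEq A] in
theorem schmidtWeight_monotone (ψ : BipartiteSpace A B) : Monotone (schmidtWeight ψ) :=
  fun _ _ h => (reducedDensity_isHermitian ψ).eigenvalues₀_antitone
    (Fin.le_def.2 (Fin.le_def.1 (Fin.rev_le_rev.2 h)))

/-- An orthonormal family, some of whose members may be missing, fills prescribed columns of a
unitary matrix. -/
theorem exists_unitary_with_columns {κ : Type*} (α : κ ↪ A) (J : Set κ)
    (w : κ → EuclideanSpace ℂ A) (hw : Orthonormal ℂ fun j : J => w j) :
    ∃ U : Matrix A A ℂ, Uᴴ * U = 1 ∧ ∀ j ∈ J, ∀ a, U a (α j) = w j a := by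
  have horth : Orthonormal ℂ ((α '' J).domRestrict (Function.extend α w 0)) := by
    have h := hw.comp (Equiv.Set.image α J α.injective).symm (Equiv.injective _)
    convert h using 1
    ext1 x
    obtain ⟨y, rfl⟩ := (Equiv.Set.image α J α.injective).surjective x
    simp [Set.domRestrict, α.injective.extend_apply]
  obtain ⟨b, hb⟩ := horth.exists_orthonormalBasis_extension_of_card_eq (by simp)
  refine ⟨(EuclideanSpace.basisFun A ℂ).toBasis.toMatrix b.toBasis, ?_, fun j hj a => ?_⟩
  · exact Matrix.mem_unitaryGroup_iff'.1
      ((EuclideanSpace.basisFun A ℂ).toMatrix_orthonormalBasis_mem_unitary b)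
  · have h := hb (α j) ⟨j, hj, rfl⟩
    rw [α.injective.extend_apply] at h
    rw [← h]
    rfl

/-- The matrix with the entries `√(s j)` at the positions `(β j, α j)`: the coordinate matrix of
`∑ j, √(s j) |α j⟩ ⊗ |β j⟩`. -/
noncomputable def schmidtMatrix {κ : Type*} [Fintype κ] (α : κ ↪ A) (β : κ ↪ B) (s : κ → ℝ) :
    Matrix B A ℂ :=
  Matrix.of fun b a => ∑ j, if b = β j ∧ a = α j then ((√(s j) : ℝ) : ℂ) else 0

theorem mul_schmidtMatrix_mul_transpose {κ : Type*} [Fintype κ] (α : κ ↪ A) (β : κ ↪ B)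
    (s : κ → ℝ) (U : Matrix A A ℂ) (V : Matrix B B ℂ) (b : B) (a : A) :
    (V * schmidtMatrix α β s * Uᵀ) b a = ∑ j, V b (β j) * ((√(s j) : ℝ) : ℂ) * U a (α j) := by
  simp only [schmidtMatrix, Matrix.mul_apply, Matrix.of_apply, Matrix.transpose_apply,
    Finset.mul_sum, Finset.sum_mul]
  simp_rw [Finset.sum_comm (s := (Finset.univ : Finset B))]
  rw [Finset.sum_comm]
  simp [ite_and]

/-- **Schmidt decomposition**: up to local unitaries, a state is determined by its Schmidt
weights, which can be placed along arbitrary vectors of the two standard bases. -/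
theorem exists_schmidt_decomposition (ψ : BipartiteSpace A B)
    (α : Fin (min (Fintype.card A) (Fintype.card B)) ↪ A)
    (β : Fin (min (Fintype.card A) (Fintype.card B)) ↪ B) :
    ∃ (U : Matrix A A ℂ) (V : Matrix B B ℂ), Uᴴ * U = 1 ∧ Vᴴ * V = 1 ∧
      coeffMatrix ψ = V * schmidtMatrix α β (schmidtWeight ψ) * Uᵀ := by
  set hH := reducedDensity_isHermitian ψ with hHdef
  set G := coeffMatrix ψ with hG
  set E : Matrix B B ℂ := (hH.eigenvectorUnitary : Matrix B B ℂ) with hE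
  have hEE : Eᴴ * E = 1 := hH.eigenvectorUnitary_conjTranspose_mul_self
  have hEE' : E * Eᴴ = 1 := hH.eigenvectorUnitary_mul_conjTranspose_self
  set M : Matrix B A ℂ := Eᴴ * G with hM
  have hMM : M * Mᴴ = Matrix.diagonal fun b => (hH.eigenvalues b : ℂ) := by
    have h : G * Gᴴ = E * Matrix.diagonal (fun b => (hH.eigenvalues b : ℂ)) * Eᴴ :=
      hH.spectralMap_eigenvalues.symm
    calc M * Mᴴ = Eᴴ * (G * Gᴴ) * E := by
          rw [hM, Matrix.conjTranspose_mul, Matrix.conjTranspose_conjTranspose]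
          simp only [Matrix.mul_assoc]
      _ = (Eᴴ * E) * Matrix.diagonal (fun b => (hH.eigenvalues b : ℂ)) * (Eᴴ * E) := by
          rw [h]; simp only [Matrix.mul_assoc]
      _ = _ := by rw [hEE, Matrix.one_mul, Matrix.mul_one]
  have hrow : ∀ b c, ∑ a, M b a * star (M c a)
      = if b = c then (hH.eigenvalues b : ℂ) else 0 := by
    intro b c
    have := congrFun (congrFun hMM b) c
    rw [Matrix.diagonal_apply] at this
    exact this
  have hzero : ∀ b, hH.eigenvalues b = 0 → ∀ a, M b a = 0 := by
    intro b hb a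
    have h := hrow b b
    rw [if_pos rfl, hb, Complex.ofReal_zero] at h
    simp only [Complex.star_def, Complex.mul_conj, ← Complex.ofReal_sum] at h
    have h2 := (Finset.sum_eq_zero_iff_of_nonneg fun a _ => Complex.normSq_nonneg (M b a)).1
      (Complex.ofReal_eq_zero.1 h) a (Finset.mem_univ a)
    exact Complex.normSq_eq_zero.1 h2
  set s := schmidtWeight ψ with hs
  set ε : Fin (min (Fintype.card A) (Fintype.card B)) → B :=
    fun j => (eigenRank B).symm (Fin.castLE (min_le_right _ _) j.rev) with hε
  have hεinj : Function.Injective ε := fun i j h =>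
    Fin.rev_injective (Fin.castLE_injective _ ((eigenRank B).symm.injective h))
  have hsε : ∀ j, hH.eigenvalues (ε j) = s j := by
    intro j
    rw [eigenvalues_eq_eigenvalues₀, hε, Equiv.apply_symm_apply]
    rfl
  have hs0 : ∀ j, 0 ≤ s j := schmidtWeight_nonneg ψ
  obtain ⟨V, hV, hVE⟩ := exists_unitary_with_columns β Set.univ
    (fun j => hH.eigenvectorBasis (ε j)) (hH.eigenvectorBasis.orthonormal.comp
      (fun j : (Set.univ : Set (Fin (min (Fintype.card A) (Fintype.card B)))) => ε j)
      (hεinj.comp Subtype.val_injective))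
  obtain ⟨U, hU, hUM⟩ := exists_unitary_with_columns α {j | s j ≠ 0}
    (fun j => WithLp.toLp 2 fun a => M (ε j) a / ((√(s j) : ℝ) : ℂ)) (by
      rw [orthonormal_iff_ite]
      intro i j
      have h := hrow (ε j) (ε i)
      simp only [PiLp.inner_apply, RCLike.inner_apply, map_div₀, Complex.conj_ofReal]
      have h2 : ∀ a, M (ε j) a / ((√(s j) : ℝ) : ℂ)
          * ((starRingEnd ℂ) (M (ε i) a) / ((√(s i) : ℝ) : ℂ))
          = (M (ε j) a * star (M (ε i) a)) / (((√(s j) : ℝ) : ℂ) * ((√(s i) : ℝ) : ℂ)) := by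
        intro a
        rw [div_mul_div_comm]; rfl
      simp only [h2, ← Finset.sum_div, h, hεinj.eq_iff]
      by_cases hij : i = j
      · subst hij
        rw [if_pos rfl, if_pos rfl, hsε, ← Complex.ofReal_mul, Real.mul_self_sqrt (hs0 _),
          div_self]
        exact Complex.ofReal_ne_zero.2 i.2
      · rw [if_neg hij, if_neg fun h => hij (Subtype.ext h.symm), zero_div])
  refine ⟨U, V, hU, hV, ?_⟩
  ext b a
  rw [mul_schmidtMatrix_mul_transpose]
  have hGM : G = E * M := by rw [hM, ← Matrix.mul_assoc, hEE', Matrix.one_mul]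
  rw [hGM, Matrix.mul_apply]
  symm
  refine Finset.sum_of_injOn ε hεinj.injOn (by simp) ?_ ?_
  · -- An eigenvector outside the range of `ε` belongs to the eigenvalue zero.
    intro c _ hc
    rw [hzero c ?_, mul_zero]
    rw [eigenvalues_eq_eigenvalues₀]
    apply eigenvalues₀_reducedDensity_eq_zero
    by_contra hlt
    refine hc ⟨(⟨(eigenRank B c).val, lt_min (not_le.1 hlt) (Fin.isLt _)⟩ : Fin _).rev,
      by simp, ?_⟩
    simp [hε]
  · intro j _
    rw [hVE j (Set.mem_univ j), mul_assoc]
    congr 1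
    by_cases hj : s j = 0
    · rw [hj, hzero _ ((hsε j).trans hj)]
      simp
    · rw [hUM j hj]
      have : ((√(s j) : ℝ) : ℂ) ≠ 0 :=
        Complex.ofReal_ne_zero.2 (Real.sqrt_ne_zero'.2 (lt_of_le_of_ne (hs0 j) (Ne.symm hj)))
      exact mul_div_cancel₀ _ this

end Schmidt

/-! ### Separable operations do not decrease the tails on average -/

section Separable

variable {A : Type u} {B : Type v} [Fintype A] [Fintype B] [DecidableEq A] [DecidableEq B]

/-- The closure condition says that `v ↦ (X l ⊗ Y l) v` is an isometry into the direct sum over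
the outcomes. -/
theorem IsSeparableOperation.sum_norm_sq {ι : Type} [Fintype ι] {X : ι → Matrix A A ℂ}
    {Y : ι → Matrix B B ℂ} (h : IsSeparableOperation X Y) (χ : BipartiteSpace A B) :
    ∑ l, ‖Matrix.toEuclideanLin (X l ⊗ₖ Y l) χ‖ ^ 2 = ‖χ‖ ^ 2 := by
  have hnorm : ∀ v : BipartiteSpace A B, ‖v‖ ^ 2 = (star v.ofLp ⬝ᵥ v.ofLp).re := by
    intro v
    rw [EuclideanSpace.norm_sq_eq, dotProduct, Complex.re_sum]
    refine Finset.sum_congr rfl fun i _ => ?_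
    rw [Pi.star_apply, Complex.star_def, mul_comm, Complex.mul_conj, Complex.ofReal_re,
      Complex.normSq_eq_norm_sq]
  have hsum : ∑ l, (X l ⊗ₖ Y l)ᴴ * (X l ⊗ₖ Y l) = 1 := by
    rw [← Matrix.one_kronecker_one, ← h]
    refine Finset.sum_congr rfl fun l _ => ?_
    rw [Matrix.conjTranspose_kronecker, Matrix.mul_kronecker_mul]
  have hterm : ∀ l, ‖Matrix.toEuclideanLin (X l ⊗ₖ Y l) χ‖ ^ 2
      = (star χ.ofLp ⬝ᵥ (((X l ⊗ₖ Y l)ᴴ * (X l ⊗ₖ Y l)) *ᵥ χ.ofLp)).re := by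
    intro l
    rw [hnorm, Matrix.ofLp_toLpLin, Matrix.toLin'_apply, Matrix.star_mulVec,
      ← Matrix.dotProduct_mulVec, Matrix.mulVec_mulVec]
  simp only [hterm]
  rw [← Complex.re_sum, ← dotProduct_sum, ← Matrix.sum_mulVec, hsum, Matrix.one_mulVec, ← hnorm]

omit [DecidableEq A] in
/-- The unnormalized outcome `√q φ` is at squared distance at least `q` times the tail of `φ` from
the matrices of small rank. -/
theorem mul_schmidtTail_le_frobeniusSq_sub
    (n : Fin (min (Fintype.card A) (Fintype.card B))) (φ : BipartiteSpace A B) {q : ℝ}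
    (hq : 0 ≤ q) (R : Matrix B A ℂ) (hR : R.rank ≤ n.rev.val) :
    q * schmidtTail n φ ≤ frobeniusSq (((√q : ℝ) : ℂ) • coeffMatrix φ - R) := by
  rcases hq.eq_or_lt with rfl | hq
  · rw [zero_mul]
    exact frobeniusSq_nonneg _
  set c : ℂ := ((√q : ℝ) : ℂ) with hc
  have hc0 : c ≠ 0 := Complex.ofReal_ne_zero.2 (Real.sqrt_ne_zero'.2 hq)
  have hrank : (c⁻¹ • R).rank ≤ n.rev.val := by
    rw [← Matrix.one_mul R, ← Matrix.smul_mul]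
    exact (Matrix.rank_mul_le_right _ _).trans hR
  have h := spectralTail_le_frobeniusSq_sub (coeffMatrix φ) (c⁻¹ • R)
    (reducedDensity_isHermitian φ) (n.rev.isLt.trans_le (min_le_right _ _)) hrank
  have heq : frobeniusSq (c • coeffMatrix φ - R) = q * frobeniusSq (coeffMatrix φ - c⁻¹ • R) := by
    have h1 : c • coeffMatrix φ - R = c • (coeffMatrix φ - c⁻¹ • R) := by
      rw [smul_sub, smul_smul, mul_inv_cancel₀ hc0, one_smul]
    rw [h1, frobeniusSq_eq_sum, frobeniusSq_eq_sum, Finset.mul_sum]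
    refine Finset.sum_congr rfl fun i _ => ?_
    rw [Finset.mul_sum]
    refine Finset.sum_congr rfl fun j _ => ?_
    rw [Matrix.smul_apply, smul_eq_mul, norm_mul, mul_pow, hc, Complex.norm_real, Real.norm_eq_abs,
      sq_abs, Real.sq_sqrt hq.le]
  rw [heq, schmidtTail_eq_spectralTail]
  exact mul_le_mul_of_nonneg_left h hq.le

/-- Necessity of the inequalities: apply the operation to `ψ` minus its best approximation of rank
`n.rev`. Product operators do not increase the rank, so the squared distance from each outcome to
the image of the approximation is at least the weighted tail of that outcome, and these squared
distances add up to the tail of `ψ`. -/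
theorem SeparablyProducible.sum_mul_schmidtTail_le {ψ : BipartiteSpace A B} {N : ℕ}
    {p : Fin N → ℝ} {φ : Fin N → BipartiteSpace A B} (h : SeparablyProducible ψ p φ)
    (n : Fin (min (Fintype.card A) (Fintype.card B))) :
    ∑ k, p k * schmidtTail n (φ k) ≤ schmidtTail n ψ := by
  obtain ⟨M, X, Y, hXY, f, q, hq, hout, hp⟩ := h
  obtain ⟨R, hR, hRψ⟩ := exists_rank_le_frobeniusSq_sub_eq (coeffMatrix ψ)
    (reducedDensity_isHermitian ψ) (r := n.rev.val) (n.rev.isLt.trans_le (min_le_right _ _)).le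
  -- The vector whose coordinate matrix is the best approximation `R` of `ψ`.
  set ρ : BipartiteSpace A B := WithLp.toLp 2 fun ab => R ab.2 ab.1
  have hsub : ∀ χ : BipartiteSpace A B, coeffMatrix (χ - ρ) = coeffMatrix χ - R := fun _ => rfl
  have hterm : ∀ l, q l * schmidtTail n (φ (f l))
      ≤ ‖Matrix.toEuclideanLin (X l ⊗ₖ Y l) (ψ - ρ)‖ ^ 2 := by
    intro l
    have h1 : (Y l * R * (X l)ᵀ).rank ≤ n.rev.val :=
      (Matrix.rank_mul_le_left _ _).trans ((Matrix.rank_mul_le_right _ _).trans hR)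
    have h2 := mul_schmidtTail_le_frobeniusSq_sub n (φ (f l)) (hq l) _ h1
    rw [← coeffMatrix_smul, ← hout, coeffMatrix_kronecker] at h2
    rwa [norm_sq_eq_frobeniusSq, coeffMatrix_kronecker, hsub, Matrix.mul_sub, Matrix.sub_mul]
  calc ∑ k, p k * schmidtTail n (φ k) = ∑ l, q l * schmidtTail n (φ (f l)) := by
        rw [← Finset.sum_fiberwise Finset.univ f]
        refine Finset.sum_congr rfl fun k _ => ?_
        rw [← hp, Finset.sum_mul]
        refine Finset.sum_congr rfl fun l hl => ?_
        rw [(Finset.mem_filter.1 hl).2]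
    _ ≤ ∑ l, ‖Matrix.toEuclideanLin (X l ⊗ₖ Y l) (ψ - ρ)‖ ^ 2 :=
        Finset.sum_le_sum fun l _ => hterm l
    _ = schmidtTail n ψ := by
        rw [hXY.sum_norm_sq, norm_sq_eq_frobeniusSq, hsub]
        exact hRψ.trans (schmidtTail_eq_spectralTail n ψ).symm

end Separable

/-! ### LOCC protocols are separable operations -/

section LOCC

variable {A : Type u} {B : Type v} [Fintype A] [Fintype B] [DecidableEq A] [DecidableEq B]

theorem LOCCProtocol.isSeparableOperation (P : LOCCProtocol A B) :
    IsSeparableOperation P.aliceKraus P.bobKraus := by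
  unfold IsSeparableOperation
  rw [Matrix.one_kronecker_one]
  induction P with
  | done =>
    refine (Fintype.sum_unique (ι := Unit) _).trans ?_
    simp [aliceKraus, bobKraus]
  | alice m K hK next ih =>
    have hterm : ∀ i, ∑ h : (next i).History,
        ((((next i).aliceKraus h * K i)ᴴ * ((next i).aliceKraus h * K i)) ⊗ₖ
          (((next i).bobKraus h)ᴴ * (next i).bobKraus h)) = ((K i)ᴴ * K i) ⊗ₖ (1 : Matrix B B ℂ) := by
      intro i
      have h1 : ∀ h : (next i).History,
          ((((next i).aliceKraus h * K i)ᴴ * ((next i).aliceKraus h * K i)) ⊗ₖ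
            (((next i).bobKraus h)ᴴ * (next i).bobKraus h))
          = ((K i)ᴴ ⊗ₖ (1 : Matrix B B ℂ)) * ((((next i).aliceKraus h)ᴴ * (next i).aliceKraus h) ⊗ₖ
            (((next i).bobKraus h)ᴴ * (next i).bobKraus h)) * (K i ⊗ₖ (1 : Matrix B B ℂ)) := by
        intro h
        rw [← Matrix.mul_kronecker_mul, ← Matrix.mul_kronecker_mul, Matrix.one_mul,
          Matrix.mul_one, Matrix.conjTranspose_mul]
        simp only [Matrix.mul_assoc]
      simp only [h1]
      rw [← Finset.sum_mul, ← Finset.mul_sum, ih, Matrix.mul_one, ← Matrix.mul_kronecker_mul,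
        Matrix.one_mul]
    refine (Fintype.sum_sigma (fun l : Σ i, (next i).History =>
      ((((next l.1).aliceKraus l.2 * K l.1)ᴴ * ((next l.1).aliceKraus l.2 * K l.1)) ⊗ₖ
          (((next l.1).bobKraus l.2)ᴴ * (next l.1).bobKraus l.2)))).trans ?_
    simp only [hterm]
    rw [← Matrix.one_kronecker_one, ← hK]
    exact (map_sum ((Matrix.kroneckerBilinear (R := ℂ) (α := ℂ)).flip (1 : Matrix B B ℂ)) _ _).symm
  | bob m K hK next ih =>
    have hterm : ∀ i, ∑ h : (next i).History,
        ((((next i).aliceKraus h)ᴴ * (next i).aliceKraus h) ⊗ₖ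
          (((next i).bobKraus h * K i)ᴴ * ((next i).bobKraus h * K i)))
          = (1 : Matrix A A ℂ) ⊗ₖ ((K i)ᴴ * K i) := by
      intro i
      have h1 : ∀ h : (next i).History,
          ((((next i).aliceKraus h)ᴴ * (next i).aliceKraus h) ⊗ₖ
            (((next i).bobKraus h * K i)ᴴ * ((next i).bobKraus h * K i)))
          = ((1 : Matrix A A ℂ) ⊗ₖ (K i)ᴴ) * ((((next i).aliceKraus h)ᴴ * (next i).aliceKraus h) ⊗ₖ
            (((next i).bobKraus h)ᴴ * (next i).bobKraus h)) * ((1 : Matrix A A ℂ) ⊗ₖ K i) := by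
        intro h
        rw [← Matrix.mul_kronecker_mul, ← Matrix.mul_kronecker_mul, Matrix.one_mul,
          Matrix.mul_one, Matrix.conjTranspose_mul]
        simp only [Matrix.mul_assoc]
      simp only [h1]
      rw [← Finset.sum_mul, ← Finset.mul_sum, ih, Matrix.mul_one, ← Matrix.mul_kronecker_mul,
        Matrix.one_mul]
    refine (Fintype.sum_sigma (fun l : Σ i, (next i).History =>
      ((((next l.1).aliceKraus l.2)ᴴ * (next l.1).aliceKraus l.2) ⊗ₖ
          (((next l.1).bobKraus l.2 * K l.1)ᴴ * ((next l.1).bobKraus l.2 * K l.1))))).trans ?_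
    simp only [hterm]
    rw [← Matrix.one_kronecker_one, ← hK]
    exact (map_sum (Matrix.kroneckerBilinear (R := ℂ) (α := ℂ) (1 : Matrix A A ℂ)) _ _).symm

theorem LOCCProducible.separablyProducible {ψ : BipartiteSpace A B} {N : ℕ}
    {p : Fin N → ℝ} {φ : Fin N → BipartiteSpace A B} (h : LOCCProducible ψ p φ) :
    SeparablyProducible ψ p φ := by
  obtain ⟨P, f, q, hq, hout, hp⟩ := h
  set e := Fintype.equivFin P.History
  refine ⟨Fintype.card P.History, P.aliceKraus ∘ e.symm, P.bobKraus ∘ e.symm, ?_,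
    f ∘ e.symm, q ∘ e.symm, fun l => hq _, fun l => hout _, fun k => ?_⟩
  · refine Eq.trans ?_ P.isSeparableOperation
    exact e.symm.sum_comp fun l => ((P.aliceKraus l)ᴴ * P.aliceKraus l) ⊗ₖ
      ((P.bobKraus l)ᴴ * P.bobKraus l)
  · rw [← hp k, Finset.sum_filter, Finset.sum_filter]
    exact e.symm.sum_comp fun l => if f l = k then q l else 0

/-- A measurement by Bob, followed by a unitary correction by Alice depending on the result. -/
theorem LOCCProducible.of_measurement_of_correction {ψ : BipartiteSpace A B} {N : ℕ}
    {p : Fin N → ℝ} {φ : Fin N → BipartiteSpace A B} {ι : Type} [Fintype ι]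
    (W : ι → Matrix A A ℂ) (hW : ∀ i, (W i)ᴴ * W i = 1)
    (K : ι → Matrix B B ℂ) (hK : ∑ i, (K i)ᴴ * K i = 1) (f : ι → Fin N) (q : ι → ℝ)
    (hq : ∀ i, 0 ≤ q i)
    (hout : ∀ i, Matrix.toEuclideanLin (W i ⊗ₖ K i) ψ = ((√(q i) : ℝ) : ℂ) • φ (f i))
    (hp : ∀ k, ∑ i with f i = k, q i = p k) : LOCCProducible ψ p φ := by
  set e := Fintype.equivFin ι
  set P : LOCCProtocol A B := .bob (Fintype.card ι) (fun i => K (e.symm i))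
    (by rw [← hK]; exact e.symm.sum_comp fun i => (K i)ᴴ * K i)
    (fun i => .alice 1 (fun _ => W (e.symm i)) (by simpa using hW _) fun _ => .done) with hP
  let E : P.History ≃ ι :=
    { toFun := fun l => e.symm l.1
      invFun := fun i => ⟨e i, 0, ()⟩
      left_inv := by
        rintro ⟨i, j, l⟩
        have hj : j = 0 := Subsingleton.elim _ _
        subst hj
        refine Sigma.ext (e.apply_symm_apply i) ?_
        rfl
      right_inv := fun i => e.symm_apply_apply i }
  refine ⟨P, f ∘ E, q ∘ E, fun l => hq _, ?_, fun k => ?_⟩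
  · rintro ⟨i, j, l⟩
    have h := hout (e.symm i)
    have hA : P.aliceKraus ⟨i, j, l⟩ = W (e.symm i) := Matrix.one_mul _
    have hB : P.bobKraus ⟨i, j, l⟩ = K (e.symm i) := Matrix.one_mul _
    rw [hA, hB]
    exact h
  · rw [← hp k, Finset.sum_filter, Finset.sum_filter]
    exact E.sum_comp fun i => if f i = k then q i else 0

end LOCC

/-! ### A protocol for an ensemble that satisfies the inequalities -/

section Protocol

variable {A : Type u} {B : Type v} [Fintype A] [Fintype B] [DecidableEq A] [DecidableEq B]

omit [DecidableEq A] in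
theorem sum_schmidtWeight (ψ : BipartiteSpace A B)
    (hD : 0 < min (Fintype.card A) (Fintype.card B)) : ∑ j, schmidtWeight ψ j = ‖ψ‖ ^ 2 := by
  have hlast : ∑ j, schmidtWeight ψ j
      = schmidtTail ⟨min (Fintype.card A) (Fintype.card B) - 1, by omega⟩ ψ := by
    refine Finset.sum_congr ?_ fun _ _ => rfl
    ext j
    simp only [Finset.mem_univ, Finset.mem_Iic, Fin.le_def, true_iff]
    omega
  have h := (reducedDensity_isHermitian ψ).trace_eq_sum_eigenvalues
  rw [hlast, schmidtTail_eq_spectralTail, Matrix.IsHermitian.spectralTail_eq_sum,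
    norm_sq_eq_frobeniusSq, frobeniusSq, ← reducedDensity_eq, h, Complex.re_sum]
  refine Finset.sum_congr rfl fun b _ => ?_
  rw [if_pos, mul_one]
  · rfl
  · simp only [Fin.rev, Nat.sub_add_cancel hD]
    omega

/-- The Schmidt decomposition with the weights in a prescribed order. -/
theorem exists_schmidt_decomposition_perm (ψ : BipartiteSpace A B)
    (α : Fin (min (Fintype.card A) (Fintype.card B)) ↪ A)
    (β : Fin (min (Fintype.card A) (Fintype.card B)) ↪ B)
    (σ : Equiv.Perm (Fin (min (Fintype.card A) (Fintype.card B)))) :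
    ∃ (U : Matrix A A ℂ) (V : Matrix B B ℂ), Uᴴ * U = 1 ∧ Vᴴ * V = 1 ∧
      coeffMatrix ψ = V * schmidtMatrix α β (schmidtWeight ψ ∘ σ) * Uᵀ := by
  obtain ⟨U, V, hU, hV, h⟩ := exists_schmidt_decomposition ψ (σ.symm.toEmbedding.trans α)
    (σ.symm.toEmbedding.trans β)
  refine ⟨U, V, hU, hV, h.trans ?_⟩
  congr 2
  ext b a
  simp only [schmidtMatrix, Matrix.of_apply]
  refine (Equiv.sum_comp σ _).symm.trans ?_
  simp

omit [Fintype A] in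
/-- If the weights `x` are the averages `∑ i, q i * y i`, Bob can turn the Schmidt vector with
weights `x` into the one with weights `y i`, with probability `q i`, by a diagonal measurement. -/
theorem exists_diagonal_measurement {κ ι : Type*} [Fintype κ] [Fintype ι] (α : κ ↪ A) (β : κ ↪ B)
    (x : κ → ℝ) (y : ι → κ → ℝ) (q : ι → ℝ) (hq : ∀ i, 0 ≤ q i) (hq1 : ∑ i, q i = 1)
    (hy : ∀ i j, 0 ≤ y i j) (hx : ∀ j, x j = ∑ i, q i * y i j) :
    ∃ T : ι → Matrix B B ℂ, ∑ i, (T i)ᴴ * T i = 1 ∧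
      ∀ i, T i * schmidtMatrix α β x = ((√(q i) : ℝ) : ℂ) • schmidtMatrix α β (y i) := by
  have hx0 : ∀ j, 0 ≤ x j := fun j => by
    rw [hx]
    exact Finset.sum_nonneg fun i _ => mul_nonneg (hq i) (hy i j)
  -- Where `x j = 0` the vector has no component, and any weights of total one will do.
  set t : ι → κ → ℝ := fun i j => if x j = 0 then q i else q i * y i j / x j with ht
  have ht0 : ∀ i j, 0 ≤ t i j := by
    intro i j
    simp only [ht]
    split_ifs
    exacts [hq i, div_nonneg (mul_nonneg (hq i) (hy i j)) (hx0 j)]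
  have ht1 : ∀ j, ∑ i, t i j = 1 := by
    intro j
    by_cases hj : x j = 0
    · simpa [ht, hj] using hq1
    · simp only [ht, if_neg hj]
      rw [← Finset.sum_div, ← hx, div_self hj]
  have htx : ∀ i j, t i j * x j = q i * y i j := by
    intro i j
    by_cases hj : x j = 0
    · have h0 : ∑ i, q i * y i j = 0 := by rw [← hx, hj]
      rw [hj, mul_zero, (Finset.sum_eq_zero_iff_of_nonneg
        fun i _ => mul_nonneg (hq i) (hy i j)).1 h0 i (Finset.mem_univ i)]
    · simp only [ht, if_neg hj]
      exact div_mul_cancel₀ _ hj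
  set s : ι → B → ℝ := fun i => Function.extend β (t i) fun _ => q i with hs
  have hsβ : ∀ i j, s i (β j) = t i j := fun i j => β.injective.extend_apply _ _ _
  have hs0 : ∀ i b, 0 ≤ s i b ∧ ∑ i, s i b = 1 := by
    intro i b
    by_cases hb : ∃ j, β j = b
    · obtain ⟨j, rfl⟩ := hb
      simp only [hsβ]
      exact ⟨ht0 i j, ht1 j⟩
    · simp only [hs, Function.extend_apply' _ _ _ hb]
      exact ⟨hq i, hq1⟩
  refine ⟨fun i => Matrix.diagonal fun b => ((√(s i b) : ℝ) : ℂ), ?_, fun i => ?_⟩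
  · have h1 : ∀ i, (Matrix.diagonal fun b => ((√(s i b) : ℝ) : ℂ))ᴴ
        * (Matrix.diagonal fun b => ((√(s i b) : ℝ) : ℂ))
        = Matrix.diagonal fun b => ((s i b : ℝ) : ℂ) := by
      intro i
      rw [Matrix.diagonal_conjTranspose, Matrix.diagonal_mul_diagonal]
      congr 1
      ext b
      rw [Pi.star_apply, Complex.star_def, Complex.conj_ofReal, ← Complex.ofReal_mul,
        Real.mul_self_sqrt (hs0 i b).1]
    simp only [h1]
    ext b c
    rw [Matrix.sum_apply, Matrix.one_apply]
    by_cases hbc : b = c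
    · subst hbc
      simp only [Matrix.diagonal_apply_eq, if_true]
      have hne : Nonempty ι := by
        by_contra hι
        rw [not_nonempty_iff] at hι
        simp at hq1
      rw [← Complex.ofReal_sum, (hs0 hne.some b).2, Complex.ofReal_one]
    · simp [hbc]
  · ext b a
    rw [Matrix.diagonal_mul, Matrix.smul_apply, smul_eq_mul, schmidtMatrix, schmidtMatrix,
      Matrix.of_apply, Matrix.of_apply, Finset.mul_sum, Finset.mul_sum]
    refine Finset.sum_congr rfl fun j _ => ?_
    by_cases h : b = β j ∧ a = α j
    · rw [if_pos h, if_pos h, h.1, hsβ, ← Complex.ofReal_mul, ← Complex.ofReal_mul,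
        ← Real.sqrt_mul (ht0 i j), ← Real.sqrt_mul (hq i), htx]
    · rw [if_neg h, if_neg h, mul_zero, mul_zero]

/-- Sufficiency of the inequalities: the weights of `ψ` are an average, over permutations `σ` and
indices `k`, of the permuted weights of `φ k`. Bob measures the pair `(σ, k)` diagonally in the
Schmidt basis, and both parties rotate the result to `φ k`. -/
theorem LOCCProducible.of_sum_mul_schmidtTail_le (ψ : BipartiteSpace A B) (hψ : ‖ψ‖ = 1)
    {N : ℕ} (p : Fin N → ℝ) (φ : Fin N → BipartiteSpace A B)
    (hp : ∀ k, 0 ≤ p k) (hp_sum : ∑ k, p k = 1) (hφ : ∀ k, ‖φ k‖ = 1)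
    (h : ∀ n : Fin (min (Fintype.card A) (Fintype.card B)),
        ∑ k, p k * schmidtTail n (φ k) ≤ schmidtTail n ψ) : LOCCProducible ψ p φ := by
  have hne : Nonempty (A × B) := by
    by_contra hAB
    rw [not_nonempty_iff] at hAB
    rw [Subsingleton.elim ψ 0, norm_zero] at hψ
    exact zero_ne_one hψ
  have hD : 0 < min (Fintype.card A) (Fintype.card B) :=
    lt_min (Fintype.card_pos_iff.2 ⟨hne.some.1⟩) (Fintype.card_pos_iff.2 ⟨hne.some.2⟩)
  obtain ⟨w, hw0, hw1, hw⟩ := exists_convex_combination_perm (schmidtWeight ψ)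
    (fun j => ∑ k, p k * schmidtWeight (φ k) j) (schmidtWeight_monotone ψ)
    (fun n => by
      refine le_of_eq_of_le ?_ (h n)
      rw [Finset.sum_comm]
      exact Finset.sum_congr rfl fun k _ => (Finset.mul_sum _ _ _).symm)
    (by
      rw [sum_schmidtWeight ψ hD, hψ, Finset.sum_comm]
      simp only [← Finset.mul_sum, sum_schmidtWeight _ hD, hφ, one_pow, mul_one, hp_sum])
  set α : Fin (min (Fintype.card A) (Fintype.card B)) ↪ A :=
    (Fin.castLEEmb (min_le_left _ _)).trans (Fintype.equivFin A).symm.toEmbedding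
  set β : Fin (min (Fintype.card A) (Fintype.card B)) ↪ B :=
    (Fin.castLEEmb (min_le_right _ _)).trans (Fintype.equivFin B).symm.toEmbedding
  obtain ⟨U₀, V₀, hU₀, hV₀, hψUV⟩ := exists_schmidt_decomposition ψ α β
  choose U V hU hV hφUV using fun i : Equiv.Perm (Fin (min (Fintype.card A) (Fintype.card B))) ×
    Fin N => exists_schmidt_decomposition_perm (φ i.2) α β i.1
  have hq0 : ∀ i : Equiv.Perm (Fin (min (Fintype.card A) (Fintype.card B))) × Fin N,
      0 ≤ w i.1 * p i.2 := fun i => mul_nonneg (hw0 _) (hp _)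
  obtain ⟨T, hT1, hT⟩ := exists_diagonal_measurement α β (schmidtWeight ψ)
    (fun i : Equiv.Perm (Fin (min (Fintype.card A) (Fintype.card B))) × Fin N =>
      schmidtWeight (φ i.2) ∘ i.1) (fun i => w i.1 * p i.2) hq0
    (by rw [Fintype.sum_prod_type]; simp only [← Finset.mul_sum, hp_sum, mul_one, hw1])
    (fun i j => schmidtWeight_nonneg _ _)
    (fun j => by
      rw [hw j, Fintype.sum_prod_type]
      simp only [Finset.mul_sum, mul_assoc, Function.comp_apply])
  have hU₀' : U₀ * U₀ᴴ = 1 := mul_eq_one_comm.1 hU₀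
  have hV₀' : V₀ * V₀ᴴ = 1 := mul_eq_one_comm.1 hV₀
  refine LOCCProducible.of_measurement_of_correction (fun i => U i * U₀ᴴ) (fun i => ?_)
    (fun i => V i * T i * V₀ᴴ) ?_ (fun i => i.2) (fun i => w i.1 * p i.2) hq0 (fun i => ?_)
    fun k => ?_
  · rw [Matrix.conjTranspose_mul, Matrix.conjTranspose_conjTranspose, Matrix.mul_assoc,
      ← Matrix.mul_assoc (U i)ᴴ, hU, Matrix.one_mul, hU₀']
  · have h1 : ∀ i, (V i * T i * V₀ᴴ)ᴴ * (V i * T i * V₀ᴴ) = V₀ * ((T i)ᴴ * T i) * V₀ᴴ := by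
      intro i
      calc (V i * T i * V₀ᴴ)ᴴ * (V i * T i * V₀ᴴ)
          = V₀ * ((T i)ᴴ * ((V i)ᴴ * V i) * T i) * V₀ᴴ := by
            simp only [Matrix.conjTranspose_mul, Matrix.conjTranspose_conjTranspose,
              Matrix.mul_assoc]
        _ = _ := by rw [hV, Matrix.mul_one]
    simp only [h1]
    rw [← Finset.sum_mul, ← Finset.mul_sum, hT1, Matrix.mul_one, hV₀']
  · apply coeffMatrix_injective
    rw [coeffMatrix_kronecker, coeffMatrix_smul, hψUV, hφUV i]
    calc V i * T i * V₀ᴴ * (V₀ * schmidtMatrix α β (schmidtWeight ψ) * U₀ᵀ) * (U i * U₀ᴴ)ᵀ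
        = V i * (T i * ((V₀ᴴ * V₀) * schmidtMatrix α β (schmidtWeight ψ))) *
            (U₀ᴴ * U₀)ᵀ * (U i)ᵀ := by
          simp only [Matrix.transpose_mul, Matrix.mul_assoc]
      _ = _ := by
          rw [hV₀, hU₀, Matrix.one_mul, Matrix.transpose_one, Matrix.mul_one, hT,
            Matrix.mul_smul, Matrix.smul_mul]
  · rw [Finset.sum_filter, Fintype.sum_prod_type]
    simp [← Finset.sum_mul, hw1]

end Protocol

theorem mainTheorem1 {A : Type u} {B : Type v} [Fintype A] [Fintype B] [DecidableEq A]
    [DecidableEq B] (ψ : BipartiteSpace A B) (hψ : ‖ψ‖ = 1)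
    {N : ℕ} (p : Fin N → ℝ) (φ : Fin N → BipartiteSpace A B)
    (hp : ∀ k, 0 ≤ p k) (hp_sum : ∑ k, p k = 1) (hφ : ∀ k, ‖φ k‖ = 1) :
    (SeparablyProducible ψ p φ ↔
      ∀ n : Fin (min (Fintype.card A) (Fintype.card B)),
        ∑ k, p k * schmidtTail n (φ k) ≤ schmidtTail n ψ) ∧
    (SeparablyProducible ψ p φ ↔ LOCCProducible ψ p φ) :=
  ⟨⟨fun h => h.sum_mul_schmidtTail_le, fun h =>
      (LOCCProducible.of_sum_mul_schmidtTail_le ψ hψ p φ hp hp_sum hφ h).separablyProducible⟩,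
    fun h => LOCCProducible.of_sum_mul_schmidtTail_le ψ hψ p φ hp hp_sum hφ
      h.sum_mul_schmidtTail_le, LOCCProducible.separablyProducible⟩
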